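/- Let $A\in\mathbb R^{n\times n}$, $B\in\mathbb R^{n\times m}$, $C\in\mathbb R^{p\times n}$, $K\in\mathbb R^{m\times n}$, $L\in\mathbb R^{n\times p}$ be such that $A+BK$ and $A-LC$ are Hurwitz. Let $D_1,D_2:\mathbb R\to(0,\infty)$ be delay functions and $\phi_i(t)=t-D_i(t)$, $i\in\{1,2\}$. Assume that each $\phi_i$ is continuous on $[0,\infty)$ and continuously differentiable on $(0,\infty)$, that there are constants $\pi_0^\ast,\pi_2^\ast>0$ with $t-\phi_i(t)\ge\pi_0^\ast$ and $\phi_i'(t)\ge\pi_2^\ast$ for all $t>0$, and that $\sup_{\nu\ge\phi_i^{-1}(0)}(\nu-\phi_i(\nu))$ and $\sup_{\nu\ge\phi_i^{-1}(0)}\phi_i'(\nu)$ are finite, where $\phi_i^{-1}$ is the inverse of $\phi_i$ on $[0,\infty)$. Let $\psi(t)=\phi_1^{-1}(t)-t$ for $t\ge0$ be the exact prediction horizon. Consider the plant $$\dot Z(t)=AZ(t)+BU(t-D_1(t)),\qquad Y(t)=CZ(t-D_2(t)),$$ in closed loop with the observer–predictor output-feedback law $$\dot\xi(t)=\phi_2'(t)\bigl[A\xi(t)+BU(\phi_1(\phi_2(t)))+L(Y(t)-C\xi(t))\bigr],$$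 $$\hat Z(t)=e^{A(t-\phi_2(t))}\xi(t)+\int_{\phi_2(t)}^te^{A(t-\tau)}BU(\phi_1(\tau))\,d\tau,$$ $$\hat P(t)=e^{A\psi(t)}\hat Z(t)+\int_t^{t+\psi(t)}e^{A(t+\psi(t)-s)}BU(\phi_1(s))\,ds,\qquad U(t)=K\hat P(t).$$ The initial data are $U$ on $[\phi_1(\phi_2(0)),0]$, $Z$ on $[\phi_2(0),0]$ and $\xi(0)\in\mathbb R^n$. Differential equations are understood in the Carathéodory sense (locally absolutely continuous solutions, equation a.e.). The equation for $Z$ holds on $[\phi_2(0),\infty)$, that is, the initial history of $Z$ is itself a plant trajectory driven by the input history; the equations for $Y$ and $\xi$ hold for $t\ge0$ and the control law for $t>0$. Then there exist constants $M,C_0>0$, depending only on the matrices and the delay functions, such that all solutions of the closed loop satisfy, for all $t\ge0$, $$\Gamma(t)\le Me^{-C_0t}\,\Gamma(0),\qquad \Gamma(t):=|Z(t)|^2+|Z(t)-\hat Z(t)|^2+\sup_{\phi_1(t)\le\tau\le t}|U(\tau)|^2 .$$ -/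

import Mathlib

open MeasureTheory Set
open scoped ENNReal

noncomputable section

namespace DelayPredictor

/-- A real square matrix is Hurwitz: all its complex eigenvalues have negative real part. -/
def IsHurwitz {n : ℕ} (M : Matrix (Fin n) (Fin n) ℝ) : Prop :=
  ∀ μ ∈ spectrum ℂ (M.map (algebraMap ℝ ℂ)), μ.re < 0

/-- The time stamp `φ(t) = t - D(t)` of a delay function `D`. -/
def phi (D : ℝ → ℝ) (t : ℝ) : ℝ := t - D t

/-- The inverse `φ⁻¹(t)` of `φ : [0, ∞) → ℝ`. Under the two assumptions below, `φ` is strictly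
increasing on `[0, ∞)` with range `[φ(0), ∞)`, which contains `[0, ∞)`. -/
def phiInv (D : ℝ → ℝ) (t : ℝ) : ℝ := Function.invFunOn (phi D) (Ici 0) t

/-- The exact prediction horizon `ψ(t) = φ⁻¹(t) - t`. -/
def horizon (D : ℝ → ℝ) (t : ℝ) : ℝ := phiInv D t - t

/-- Regularity of a delay function `D : ℝ → (0, ∞)`: `φ` is `C¹` on `(0, ∞)`
and continuous up to `t = 0`. -/
structure RegularDelay (D : ℝ → ℝ) : Prop where
  pos : ∀ t, 0 < D t
  contDiffOn : ContDiffOn ℝ 1 (phi D) (Ioi 0)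
  continuousOn : ContinuousOn (phi D) (Ici 0)

/-- The delay is bounded away from zero, and `sup_{ν ≥ φ⁻¹(0)} (ν - φ(ν))` is finite. -/
structure DelayPositiveBounded (D : ℝ → ℝ) : Prop where
  lower : ∃ π₀ > 0, ∀ t > 0, π₀ ≤ t - phi D t
  upper : BddAbove ((fun ν => ν - phi D ν) '' Ici (phiInv D 0))

/-- The derivative of `φ` is bounded away from zero, and `sup_{ν ≥ φ⁻¹(0)} φ'(ν)` is finite. -/
structure DelayInvertible (D : ℝ → ℝ) : Prop where
  lower : ∃ π₂ > 0, ∀ t > 0, π₂ ≤ deriv (phi D) t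
  upper : BddAbove (deriv (phi D) '' Ici (phiInv D 0))

/-- The data of the control problem: plant matrices `A, B, C`, feedback gain `K`, observer gain
`L`, input delay `D₁` and measurement delay `D₂`. -/
structure ControlSystem (n m p : ℕ) where
  A : Matrix (Fin n) (Fin n) ℝ
  B : Matrix (Fin n) (Fin m) ℝ
  C : Matrix (Fin p) (Fin n) ℝ
  K : Matrix (Fin m) (Fin n) ℝ
  L : Matrix (Fin n) (Fin p) ℝ
  D₁ : ℝ → ℝ
  D₂ : ℝ → ℝ

/-- `x` is a (Carathéodory) solution of `ẋ(t) = v(t)` on `[t₀, ∞)`: `v` is integrable on bounded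
intervals and `x` is its integral, that is, `x` is locally absolutely continuous on `[t₀, ∞)` with
`ẋ = v` almost everywhere. -/
def SolvesFrom {n : ℕ} (t₀ : ℝ) (x v : ℝ → EuclideanSpace ℝ (Fin n)) : Prop :=
  ∀ t ≥ t₀, IntervalIntegrable v volume t₀ t ∧ x t = x t₀ + ∫ s in t₀..t, v s

namespace ControlSystem

variable {n m p : ℕ} (S : ControlSystem n m p)

/-- `φ₁(t) = t - D₁(t)`. -/
def φ₁ : ℝ → ℝ := phi S.D₁

/-- `φ₂(t) = t - D₂(t)`. -/
def φ₂ : ℝ → ℝ := phi S.D₂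

/-- `ψ(t) = φ₁⁻¹(t) - t`. -/
def ψ : ℝ → ℝ := horizon S.D₁

/-- The vector `e^{A r} x`. -/
def flow (r : ℝ) (x : EuclideanSpace ℝ (Fin n)) : EuclideanSpace ℝ (Fin n) :=
  Matrix.toEuclideanLin (NormedSpace.exp (r • S.A)) x

/-- The current-state estimate
`Ẑ(t) = e^{A(t - φ₂(t))} ξ(t) + ∫_{φ₂(t)}^t e^{A(t - τ)} B U(φ₁(τ)) dτ`. -/
def Zhat (U : ℝ → EuclideanSpace ℝ (Fin m)) (ξ : ℝ → EuclideanSpace ℝ (Fin n)) (t : ℝ) :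
    EuclideanSpace ℝ (Fin n) :=
  S.flow (t - S.φ₂ t) (ξ t) +
    ∫ τ in (S.φ₂ t)..t, S.flow (t - τ) (Matrix.toEuclideanLin S.B (U (S.φ₁ τ)))

/-- The predictor, with the exact horizon `ψ`,
`P̂(t) = e^{A ψ(t)} Ẑ(t) + ∫_t^{t + ψ(t)} e^{A(t + ψ(t) - s)} B U(φ₁(s)) ds`. -/
def Phat (U : ℝ → EuclideanSpace ℝ (Fin m)) (ξ : ℝ → EuclideanSpace ℝ (Fin n)) (t : ℝ) :
    EuclideanSpace ℝ (Fin n) :=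
  S.flow (S.ψ t) (S.Zhat U ξ t) +
    ∫ s in t..(t + S.ψ t), S.flow (t + S.ψ t - s) (Matrix.toEuclideanLin S.B (U (S.φ₁ s)))

/-- `(Z, Y, U, ξ)` is a solution of the plant in closed loop with the exact output-feedback law.
The values of `Z` on `[φ₂(0), 0]`, of `U` up to time `0`, and `ξ(0)` are the initial data;
the plant equation also governs `Z` on the initial interval `[φ₂(0), 0]`. The control law is
imposed for `t > 0` only, so that `U(0)` may be either part of the initial data or given
by the law. -/
structure IsClosedLoopSolution (Z : ℝ → EuclideanSpace ℝ (Fin n)) (Y : ℝ → EuclideanSpace ℝ (Fin p))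
    (U : ℝ → EuclideanSpace ℝ (Fin m)) (ξ : ℝ → EuclideanSpace ℝ (Fin n)) : Prop where
  /-- `Ż(t) = A Z(t) + B U(t - D₁(t))` -/
  plant : SolvesFrom (S.φ₂ 0) Z fun t =>
    Matrix.toEuclideanLin S.A (Z t) + Matrix.toEuclideanLin S.B (U (t - S.D₁ t))
  /-- `Y(t) = C Z(t - D₂(t))` -/
  output : ∀ t ≥ 0, Y t = Matrix.toEuclideanLin S.C (Z (t - S.D₂ t))
  /-- `ξ'(t) = φ₂'(t) [A ξ(t) + B U(φ₁(φ₂(t))) + L (Y(t) - C ξ(t))]` -/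
  observer : SolvesFrom 0 ξ fun t =>
    deriv S.φ₂ t • (Matrix.toEuclideanLin S.A (ξ t) +
      Matrix.toEuclideanLin S.B (U (S.φ₁ (S.φ₂ t))) +
      Matrix.toEuclideanLin S.L (Y t - Matrix.toEuclideanLin S.C (ξ t)))
  /-- `U(t) = K P̂(t)` -/
  control : ∀ t > 0, U t = Matrix.toEuclideanLin S.K (S.Phat U ξ t)

/-- `Γ(t) = |Z(t)|² + |Z(t) - Ẑ(t)|² + sup_{φ₁(t) ≤ τ ≤ t} |U(τ)|²`, with values in `[0, ∞]`. -/
def Gam (Z : ℝ → EuclideanSpace ℝ (Fin n)) (U : ℝ → EuclideanSpace ℝ (Fin m))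
    (ξ : ℝ → EuclideanSpace ℝ (Fin n)) (t : ℝ) : ℝ≥0∞ :=
  ‖Z t‖ₑ ^ 2 + ‖Z t - S.Zhat U ξ t‖ₑ ^ 2 + ⨆ τ ∈ Icc (S.φ₁ t) t, ‖U τ‖ₑ ^ 2

end ControlSystem

end DelayPredictor

end

/-!
Run on the clock `φ₂`, the observer is an ordinary Luenberger observer, so `Z ∘ φ₂ - ξ` equals
`e^{(φ₂(t) - φ₂(0))(A - LC)}` applied to its initial value. It decays because `φ₂` grows at least
linearly, and `Z - Ẑ` is its image under the plant flow over a bounded time. By variation of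
constants the predictor errs only by the flow of `Z - Ẑ`, so `U(φ₁(s)) = K Z(s)` up to an
exponentially small mismatch once `φ₁(s) > 0`; the remaining `s` are bounded and contribute only a
constant. Hence `Ż = (A + BK) Z` up to an exponentially small forcing, and `Z` decays. Finally every
`τ ∈ [φ₁(t), t]` is `φ₁(s)` for some `s ≥ t`, which bounds the input.
-/

namespace DelayPredictor

section MatrixExponential

open NormedSpace Filter Topology

theorem le_of_forall_add_le {f : ℝ → ℝ} {T C : ℝ} (hT : 0 < T)
    (hf : ∀ s ≥ 0, f (s + T) ≤ f s) (hC : ∀ s ∈ Icc 0 T, f s ≤ C) {t : ℝ} (ht : 0 ≤ t) :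
    f t ≤ C := by
  obtain ⟨N, hN⟩ := exists_nat_ge (t / T)
  rw [div_le_iff₀ hT] at hN
  induction N generalizing t with
  | zero => exact hC t ⟨ht, by simp only [CharP.cast_eq_zero, zero_mul] at hN; linarith⟩
  | succ N ih =>
    rcases le_total t T with htT | htT
    · exact hC t ⟨ht, htT⟩
    · have hs : 0 ≤ t - T := sub_nonneg.2 htT
      rw [← sub_add_cancel t T]
      refine (hf _ hs).trans (ih hs ?_)
      push_cast at hN
      linarith

theorem continuous_exp_smul {𝔸 : Type*} [NormedRing 𝔸] [NormedAlgebra ℝ 𝔸] [CompleteSpace 𝔸]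
    (a : 𝔸) : Continuous fun t : ℝ => exp (t • a) :=
  continuous_iff_continuousAt.2 fun t => (hasDerivAt_exp_smul_const a t).continuousAt

theorem exp_add_smul {𝔸 : Type*} [NormedRing 𝔸] [NormedAlgebra ℝ 𝔸] [CompleteSpace 𝔸]
    (a : 𝔸) (s t : ℝ) : exp ((s + t) • a) = exp (s • a) * exp (t • a) := by
  let _ : NormedAlgebra ℚ 𝔸 := NormedAlgebra.restrictScalars ℚ ℝ 𝔸
  rw [add_smul, exp_add_of_commute (((Commute.refl a).smul_left s).smul_right t)]

theorem exists_norm_exp_smul_le {𝔸 : Type*} [NormedRing 𝔸] [NormedAlgebra ℝ 𝔸] [CompleteSpace 𝔸]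
    {a : 𝔸} {T : ℝ} (hT : 0 < T) (h : ‖exp (T • a)‖ < 1) :
    ∃ C > 0, ∃ c > 0, ∀ t ≥ (0 : ℝ), ‖exp (t • a)‖ ≤ C * Real.exp (-c * t) := by
  have hlim : Tendsto (fun c : ℝ => Real.exp (c * T) * ‖exp (T • a)‖) (𝓝[>] 0)
      (𝓝 ‖exp (T • a)‖) := by
    refine (Continuous.tendsto' (by fun_prop) 0 _ (by simp)).mono_left nhdsWithin_le_nhds
  obtain ⟨c, hcT, hc⟩ := ((hlim.eventually_lt_const h).and self_mem_nhdsWithin).exists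
  obtain ⟨C, hC⟩ := (isCompact_Icc (a := 0) (b := T)).exists_bound_of_continuousOn
    (f := fun t : ℝ => Real.exp (c * t) * ‖exp (t • a)‖)
    (Continuous.continuousOn (by have := continuous_exp_smul a; fun_prop))
  refine ⟨max C 1, by positivity, c, hc, fun t ht => ?_⟩
  have hbound : Real.exp (c * t) * ‖exp (t • a)‖ ≤ max C 1 := by
    refine le_of_forall_add_le (f := fun t => Real.exp (c * t) * ‖exp (t • a)‖) hT
      (fun s _ => ?_) (fun s hs => (le_abs_self _).trans ((hC s hs).trans (le_max_left _ _))) ht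
    calc Real.exp (c * (s + T)) * ‖exp ((s + T) • a)‖
        ≤ Real.exp (c * s) * Real.exp (c * T) * (‖exp (s • a)‖ * ‖exp (T • a)‖) := by
          rw [mul_add, Real.exp_add, exp_add_smul]
          gcongr
          exact norm_mul_le _ _
      _ = Real.exp (c * s) * ‖exp (s • a)‖ * (Real.exp (c * T) * ‖exp (T • a)‖) := by ring
      _ ≤ Real.exp (c * s) * ‖exp (s • a)‖ := mul_le_of_le_one_right (by positivity) hcT.le
  rwa [neg_mul, Real.exp_neg, ← div_eq_mul_inv, le_div_iff₀' (Real.exp_pos _)]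

theorem exists_eigenvector_of_commute {𝕜 V : Type*} [Field 𝕜] [IsAlgClosed 𝕜] [AddCommGroup V]
    [Module 𝕜 V] [FiniteDimensional 𝕜 V] {f g : Module.End 𝕜 V} (hfg : Commute f g) {z : 𝕜}
    (hz : f.HasEigenvalue z) : ∃ (μ : 𝕜) (v : V), g.HasEigenvector μ v ∧ f v = z • v := by
  have hmaps : MapsTo g (f.eigenspace z) (f.eigenspace z) :=
    Module.End.mapsTo_genEigenspace_of_comm hfg z 1
  have : Nontrivial (f.eigenspace z) := Submodule.nontrivial_iff_ne_bot.2 hz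
  obtain ⟨μ, hμ⟩ := Module.End.exists_eigenvalue (g.restrict hmaps)
  obtain ⟨⟨v, hv⟩, hvμ⟩ := hμ.exists_hasEigenvector
  refine ⟨μ, v, Module.End.hasEigenvector_iff.2 ⟨Module.End.mem_eigenspace_iff.2 ?_, ?_⟩,
    Module.End.mem_eigenspace_iff.1 hv⟩
  · exact congrArg Subtype.val hvμ.apply_eq_smul
  · exact fun h => hvμ.2 (Subtype.ext h)

open scoped Matrix.Norms.L2Operator

variable {ι : Type*} [Fintype ι] [DecidableEq ι]

theorem exp_mulVec_of_mulVec_eq_smul {M : Matrix ι ι ℂ} {μ : ℂ} {v : ι → ℂ}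
    (h : M.mulVec v = μ • v) : (exp M).mulVec v = exp μ • v := by
  have hpow (k : ℕ) : (M ^ k).mulVec v = μ ^ k • v := by
    induction k with
    | zero => simp
    | succ k ih => rw [pow_succ, ← Matrix.mulVec_mulVec, h, Matrix.mulVec_smul, ih, smul_smul,
        pow_succ']
  have hexpM : HasSum (fun k : ℕ => ((k.factorial⁻¹ : ℂ) • M ^ k).mulVec v) ((exp M).mulVec v) :=
    (exp_series_hasSum_exp' (𝕂 := ℂ) M).map ((Matrix.mulVecBilin ℂ ℂ).flip v)
      (LinearMap.continuous_of_finiteDimensional _)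
  have hexpμ : HasSum (fun k : ℕ => (k.factorial⁻¹ : ℂ) • μ ^ k • v) (exp μ • v) := by
    simpa only [smul_assoc] using (exp_series_hasSum_exp' (𝕂 := ℂ) μ).smul_const v
  simp only [Matrix.smul_mulVec, hpow] at hexpM
  exact hexpM.unique hexpμ

theorem exists_mem_spectrum_of_mem_spectrum_exp {M : Matrix ι ι ℂ} {z : ℂ}
    (hz : z ∈ spectrum ℂ (exp M)) : ∃ μ ∈ spectrum ℂ M, exp μ = z := by
  rw [← Matrix.spectrum_toLin', ← Module.End.hasEigenvalue_iff_mem_spectrum] at hz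
  have hcomm : Commute (Matrix.toLin' (exp M)) (Matrix.toLin' M) :=
    (Commute.refl M).exp_left.map (Matrix.toLinAlgEquiv' (R := ℂ))
  obtain ⟨μ, v, hμ, hv⟩ := exists_eigenvector_of_commute hcomm hz
  refine ⟨μ, ?_, smul_left_injective ℂ hμ.2 ?_⟩
  · rw [← Matrix.spectrum_toLin', ← Module.End.hasEigenvalue_iff_mem_spectrum]
    exact Module.End.hasEigenvalue_of_hasEigenvector hμ
  · exact (exp_mulVec_of_mulVec_eq_smul hμ.apply_eq_smul).symm.trans hv

theorem exists_norm_exp_smul_lt_one {M : Matrix ι ι ℂ} (hM : ∀ μ ∈ spectrum ℂ M, μ.re < 0) :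
    ∃ T > (0 : ℝ), ‖exp (T • M)‖ < 1 := by
  let _ : NormedAlgebra ℚ (Matrix ι ι ℂ) := NormedAlgebra.restrictScalars ℚ ℝ _
  have hrad : spectralRadius ℂ (exp M) < 1 := by
    rcases isEmpty_or_nonempty ι with _ | _
    · simp [spectralRadius, spectrum.of_subsingleton]
    · refine spectrum.spectralRadius_lt_of_forall_lt (r := 1) _ fun z hz => ?_
      obtain ⟨μ, hμ, rfl⟩ := exists_mem_spectrum_of_mem_spectrum_exp hz
      rw [← Complex.exp_eq_exp_ℂ, ← NNReal.coe_lt_coe]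
      simpa [Complex.norm_exp] using hM μ hμ
  obtain ⟨k, hk, hk0⟩ := (((spectrum.pow_nnnorm_pow_one_div_tendsto_nhds_spectralRadius
    (exp M)).eventually_lt_const hrad).and (eventually_gt_atTop 0)).exists
  refine ⟨k, by exact_mod_cast hk0, ?_⟩
  rw [Nat.cast_smul_eq_nsmul, exp_nsmul]
  by_contra! hge
  exact hk.not_ge (ENNReal.one_le_rpow (by exact_mod_cast hge) (by positivity))

theorem toEuclideanCLM_exp (M : Matrix ι ι ℝ) :
    Matrix.toEuclideanCLM (𝕜 := ℝ) (exp M) = exp (Matrix.toEuclideanCLM (𝕜 := ℝ) M) := by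
  let _ : NormedAlgebra ℚ (Matrix ι ι ℝ) := NormedAlgebra.restrictScalars ℚ ℝ _
  exact map_exp (Matrix.toEuclideanCLM (n := ι) (𝕜 := ℝ)) (LinearMap.continuous_of_finiteDimensional
    (Matrix.toEuclideanCLM (n := ι) (𝕜 := ℝ)).toAlgEquiv.toLinearMap) M

theorem map_ofReal_exp (M : Matrix ι ι ℝ) :
    (exp M).map (algebraMap ℝ ℂ) = exp (M.map (algebraMap ℝ ℂ)) := by
  let _ : NormedAlgebra ℚ (Matrix ι ι ℝ) := NormedAlgebra.restrictScalars ℚ ℝ _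
  exact map_exp (algebraMap ℝ ℂ).mapMatrix (continuous_id.matrix_map Complex.continuous_ofReal) M

theorem IsHurwitz.exists_norm_exp_le {n : ℕ} {M : Matrix (Fin n) (Fin n) ℝ} (hM : IsHurwitz M) :
    ∃ C > 0, ∃ c > 0, ∀ t ≥ (0 : ℝ),
      ‖exp (t • Matrix.toEuclideanCLM (𝕜 := ℝ) M)‖ ≤ C * Real.exp (-c * t) := by
  obtain ⟨T, hT, hT1⟩ := exists_norm_exp_smul_lt_one hM
  obtain ⟨C, hC, c, hc, hdecay⟩ := exists_norm_exp_smul_le hT hT1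
  let re : Matrix (Fin n) (Fin n) ℂ →ₗ[ℝ] Matrix (Fin n) (Fin n) ℝ := Complex.reLm.mapMatrix
  obtain ⟨R, hR, hre⟩ :=
    SemilinearMapClass.bound_of_continuous re re.continuous_of_finiteDimensional
  refine ⟨R * C, by positivity, c, hc, fun t ht => ?_⟩
  have hexp : re (exp (t • M.map (algebraMap ℝ ℂ))) = exp (t • M) := by
    have hsmul : t • M.map (algebraMap ℝ ℂ) = (t • M).map (algebraMap ℝ ℂ) := by ext; simp
    rw [hsmul, ← map_ofReal_exp]
    ext
    simp [re]
  calc ‖exp (t • Matrix.toEuclideanCLM (𝕜 := ℝ) M)‖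
      = ‖re (exp (t • M.map (algebraMap ℝ ℂ)))‖ := by
        rw [hexp, ← map_smul, ← toEuclideanCLM_exp, Matrix.l2_opNorm_toEuclideanCLM]
    _ ≤ R * (C * Real.exp (-c * t)) := (hre _).trans (by gcongr; exact hdecay t ht)
    _ = R * C * Real.exp (-c * t) := by ring

end MatrixExponential

section VariationOfConstants

open NormedSpace Filter Topology

variable {E F : Type*} [NormedAddCommGroup E] [NormedSpace ℝ E]
  [NormedAddCommGroup F] [NormedSpace ℝ F]

theorem absolutelyContinuousOnInterval_of_dist_le {X Y : Type*} [PseudoMetricSpace X]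
    [PseudoMetricSpace Y] {f : ℝ → X} {g : ℝ → Y} {a b : ℝ}
    (hg : AbsolutelyContinuousOnInterval g a b)
    (h : ∀ s ∈ uIcc a b, ∀ t ∈ uIcc a b, dist (f s) (f t) ≤ dist (g s) (g t)) :
    AbsolutelyContinuousOnInterval f a b := by
  rw [absolutelyContinuousOnInterval_iff] at hg ⊢
  intro ε hε
  obtain ⟨δ, hδ, hsum⟩ := hg ε hε
  refine ⟨δ, hδ, fun I hI hIδ => (Finset.sum_le_sum fun i hi => ?_).trans_lt (hsum I hI hIδ)⟩
  exact h _ (hI.1 i hi).1 _ (hI.1 i hi).2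

theorem absolutelyContinuousOnInterval_add_integral {f : ℝ → E} {a b : ℝ} (x : E)
    (hf : IntervalIntegrable f volume a b) :
    AbsolutelyContinuousOnInterval (fun t => x + ∫ s in a..t, f s) a b := by
  refine absolutelyContinuousOnInterval_of_dist_le
    (hf.norm.absolutelyContinuousOnInterval_intervalIntegral (c := a) left_mem_uIcc) ?_
  intro s hs t ht
  have hs' : IntervalIntegrable f volume a s := hf.mono_set (uIcc_subset_uIcc left_mem_uIcc hs)
  have ht' : IntervalIntegrable f volume a t := hf.mono_set (uIcc_subset_uIcc left_mem_uIcc ht)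
  rw [dist_add_left, dist_eq_norm, dist_eq_norm,
    intervalIntegral.integral_interval_sub_left hs' ht',
    intervalIntegral.integral_interval_sub_left hs'.norm ht'.norm]
  exact intervalIntegral.norm_integral_le_abs_integral_norm

theorem dist_clm_apply_le (S T : E →L[ℝ] F) (x y : E) :
    dist (S x) (T y) ≤ ‖S‖ * dist x y + ‖y‖ * dist S T := by
  calc dist (S x) (T y) ≤ dist (S x) (S y) + dist (S y) (T y) := dist_triangle _ _ _
    _ ≤ ‖S‖ * dist x y + ‖y‖ * dist S T := by
      simp only [dist_eq_norm, ← map_sub, ← sub_apply]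
      exact add_le_add (S.le_opNorm _) (((S - T).le_opNorm y).trans_eq (mul_comm _ _))

theorem absolutelyContinuousOnInterval_clm_apply {T : ℝ → E →L[ℝ] F} {x : ℝ → E} {a b : ℝ}
    (hT : AbsolutelyContinuousOnInterval T a b) (hx : AbsolutelyContinuousOnInterval x a b) :
    AbsolutelyContinuousOnInterval (fun t => T t (x t)) a b := by
  obtain ⟨C, hC⟩ := hT.exists_bound
  obtain ⟨D, hD⟩ := hx.exists_bound
  have hlim : Tendsto (fun I : ℕ × (ℕ → ℝ × ℝ) =>
      C * ∑ i ∈ Finset.range I.1, dist (x (I.2 i).1) (x (I.2 i).2) +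
      D * ∑ i ∈ Finset.range I.1, dist (T (I.2 i).1) (T (I.2 i).2))
      (AbsolutelyContinuousOnInterval.totalLengthFilter ⊓
        𝓟 (AbsolutelyContinuousOnInterval.disjWithin a b)) (𝓝 0) := by
    unfold AbsolutelyContinuousOnInterval at hx hT
    simpa using (hx.const_mul C).add (hT.const_mul D)
  refine squeeze_zero' (.of_forall fun _ => Finset.sum_nonneg fun _ _ => dist_nonneg) ?_ hlim
  rw [eventually_inf_principal]
  filter_upwards with I hI
  simp only [Finset.mul_sum, ← Finset.sum_add_distrib]
  refine Finset.sum_le_sum fun i hi => (dist_clm_apply_le _ _ _ _).trans ?_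
  gcongr
  · exact hC _ (hI.1 i hi).1
  · exact hD _ (hI.1 i hi).2

theorem intervalIntegrable_clm_apply {T : ℝ → E →L[ℝ] F} {g : ℝ → E} {a b : ℝ}
    (hT : Continuous T) (hg : IntervalIntegrable g volume a b) :
    IntervalIntegrable (fun s => T s (g s)) volume a b := by
  obtain ⟨C, hC⟩ := (isCompact_uIcc (a := a) (b := b)).exists_bound_of_continuousOn hT.continuousOn
  rw [intervalIntegrable_iff] at hg ⊢
  refine (hg.norm.const_mul C).mono'
    ((ContinuousLinearMap.apply ℝ F).flip.aestronglyMeasurable_comp₂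
      hT.aestronglyMeasurable hg.aestronglyMeasurable) ?_
  filter_upwards [ae_restrict_mem measurableSet_uIoc] with s hs
  exact ((T s).le_opNorm _).trans (by gcongr; exact hC s (uIoc_subset_uIcc hs))

variable [CompleteSpace E] (L : E →L[ℝ] E)

theorem hasDerivAt_exp_sub_smul (b t : ℝ) :
    HasDerivAt (fun s : ℝ => exp ((b - s) • L)) (-(exp ((b - t) • L) * L)) t := by
  simpa [Function.comp_def] using
    (hasDerivAt_exp_smul_const L (b - t)).scomp t ((hasDerivAt_id t).const_sub b)

theorem continuous_exp_sub_smul (b : ℝ) : Continuous fun s : ℝ => exp ((b - s) • L) :=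
  (continuous_exp_smul L).comp (continuous_sub_left b)

theorem absolutelyContinuousOnInterval_exp_sub_smul (a b : ℝ) :
    AbsolutelyContinuousOnInterval (fun s : ℝ => exp ((b - s) • L)) a b := by
  have hcont := continuous_exp_sub_smul L b
  refine (contDiff_one_iff_deriv.2 ⟨fun t => (hasDerivAt_exp_sub_smul L b t).differentiableAt,
    ?_⟩).contDiffOn.absolutelyContinuousOnInterval
  simp only [funext fun t => (hasDerivAt_exp_sub_smul L b t).deriv]
  fun_prop

theorem exp_neg_smul_apply_exp_smul (r : ℝ) (x : E) : exp (-r • L) (exp (r • L) x) = x := by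
  have hmul : exp ((-r + r) • L) = exp (-r • L) * exp (r • L) := exp_add_smul L (-r) r
  rw [← mul_apply_eq_comp, ← hmul, neg_add_cancel, zero_smul, exp_zero, one_apply_eq_self]

theorem eq_exp_add_integral {x v : ℝ → E} {a b : ℝ} (hab : a ≤ b)
    (hv : IntervalIntegrable v volume a b)
    (hx : ∀ t ∈ Icc a b, x t = x a + ∫ s in a..t, v s) :
    x b = exp ((b - a) • L) (x a) + ∫ s in a..b, exp ((b - s) • L) (v s - L (x s)) := by
  rw [← uIcc_of_le hab] at hx
  let X : ℝ → E := fun t => x a + ∫ s in a..t, v s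
  have hX : AbsolutelyContinuousOnInterval X a b :=
    absolutelyContinuousOnInterval_add_integral (x a) hv
  have hforcing : IntervalIntegrable (fun s => exp ((b - s) • L) (v s - L (x s))) volume a b :=
    intervalIntegrable_clm_apply (continuous_exp_sub_smul L b)
      (hv.sub (L.continuous.comp_continuousOn (hX.continuousOn.congr hx)).intervalIntegrable)
  have hac := (absolutelyContinuousOnInterval_clm_apply
    (absolutelyContinuousOnInterval_exp_sub_smul L a b) hX).sub
    (absolutelyContinuousOnInterval_add_integral 0 hforcing)
  obtain ⟨y, hy⟩ := hac.const_of_ae_hasDerivAt_zero (by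
    filter_upwards [hv.ae_hasDerivAt_integral, hforcing.ae_hasDerivAt_integral] with t hvt hft ht
    convert ((hasDerivAt_exp_sub_smul L b t).clm_apply
      ((hvt ht a left_mem_uIcc).const_add (x a))).sub
      ((hft ht a left_mem_uIcc).const_add 0) using 1
    rw [← hx t ht, map_sub, neg_apply, mul_apply_eq_comp]
    abel)
  have hyab := (hy b right_mem_uIcc).trans (hy a left_mem_uIcc).symm
  simp only [Pi.sub_apply, sub_self, zero_smul, exp_zero, intervalIntegral.integral_same, sub_zero,
    one_apply_eq_self, X, add_zero, zero_add, ← hx b right_mem_uIcc] at hyab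
  exact sub_eq_iff_eq_add.1 hyab

end VariationOfConstants

section Delay

/-- The properties of a delay function on which stability rests: `φ(t) = t - D(t)` increases at
rate at least `κ > 0` on `[0, ∞)`, where the delay takes values in `[0, R]`. -/
structure IsAdmissibleDelay (D : ℝ → ℝ) (κ R : ℝ) : Prop where
  continuousOn : ContinuousOn (phi D) (Ici 0)
  differentiableOn : DifferentiableOn ℝ (phi D) (Ioi 0)
  rate_pos : 0 < κ
  le_deriv : ∀ t > 0, κ ≤ deriv (phi D) t
  mem_Icc : ∀ t ≥ 0, D t ∈ Icc 0 R

theorem RegularDelay.exists_isAdmissibleDelay {D : ℝ → ℝ} (hreg : RegularDelay D)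
    (hpos : DelayPositiveBounded D) (hinv : DelayInvertible D) :
    ∃ κ R, IsAdmissibleDelay D κ R := by
  obtain ⟨κ, hκ, hderiv⟩ := hinv.lower
  obtain ⟨R₁, hR₁⟩ := hpos.upper
  obtain ⟨R₂, hR₂⟩ := (isCompact_Icc (a := 0) (b := phiInv D 0)).exists_bound_of_continuousOn
    (continuousOn_id.sub (hreg.continuousOn.mono Icc_subset_Ici_self))
  have hD (t : ℝ) : D t = t - phi D t := (sub_sub_cancel t (D t)).symm
  refine ⟨κ, max R₁ R₂, hreg.continuousOn, hreg.contDiffOn.differentiableOn one_ne_zero, hκ, hderiv,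
    fun t ht => ⟨(hreg.pos t).le, ?_⟩⟩
  rw [hD]
  rcases le_total (phiInv D 0) t with hσ | hσ
  · exact le_max_of_le_left (hR₁ ⟨t, hσ, rfl⟩)
  · exact le_max_of_le_right ((le_abs_self _).trans (hR₂ t ⟨ht, hσ⟩))

namespace IsAdmissibleDelay

variable {D : ℝ → ℝ} {κ R : ℝ}

theorem mul_sub_le (hD : IsAdmissibleDelay D κ R) {s t : ℝ} (hs : 0 ≤ s)
    (hst : s ≤ t) : κ * (t - s) ≤ phi D t - phi D s := by
  refine (convex_Ici (0 : ℝ)).mul_sub_le_image_sub_of_le_deriv hD.continuousOn ?_ ?_ s hs t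
    (hs.trans hst) hst
  · simpa only [interior_Ici] using hD.differentiableOn
  · simpa only [interior_Ici, mem_Ioi] using hD.le_deriv

theorem strictMonoOn (hD : IsAdmissibleDelay D κ R) : StrictMonoOn (phi D) (Ici 0) := by
  intro s hs t _ hst
  have hgrowth := hD.mul_sub_le hs hst.le
  have hpos : 0 < κ * (t - s) := mul_pos hD.rate_pos (sub_pos.2 hst)
  linarith

theorem surjOn (hD : IsAdmissibleDelay D κ R) : SurjOn (phi D) (Ici 0) (Ici (phi D 0)) := by
  intro y hy
  have hT : 0 ≤ (y - phi D 0) / κ := div_nonneg (sub_nonneg.2 hy) hD.rate_pos.le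
  have hgrowth := hD.mul_sub_le le_rfl hT
  rw [sub_zero, mul_div_cancel₀ _ hD.rate_pos.ne', sub_le_sub_iff_right] at hgrowth
  exact (intermediate_value_Icc hT (hD.continuousOn.mono Icc_subset_Ici_self)).trans
    (image_mono Icc_subset_Ici_self) ⟨hy, hgrowth⟩

theorem phiInv_phi (hD : IsAdmissibleDelay D κ R) {t : ℝ} (ht : 0 ≤ t) : phiInv D (phi D t) = t :=
  hD.strictMonoOn.injOn.leftInvOn_invFunOn ht

theorem horizon_phi (hD : IsAdmissibleDelay D κ R) {t : ℝ} (ht : 0 ≤ t) :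
    horizon D (phi D t) = D t := by
  rw [horizon, hD.phiInv_phi ht, phi, sub_sub_cancel]

theorem phi_le (hD : IsAdmissibleDelay D κ R) {t : ℝ} (ht : 0 ≤ t) : phi D t ≤ t :=
  sub_le_self t (hD.mem_Icc t ht).1

theorem sub_le_phi (hD : IsAdmissibleDelay D κ R) {t : ℝ} (ht : 0 ≤ t) : t - R ≤ phi D t :=
  sub_le_sub_left (hD.mem_Icc t ht).2 t

theorem abs_le (hD : IsAdmissibleDelay D κ R) {t : ℝ} (ht : 0 ≤ t) : |D t| ≤ R := by
  rw [abs_of_nonneg (hD.mem_Icc t ht).1]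
  exact (hD.mem_Icc t ht).2

end IsAdmissibleDelay

end Delay

section CaratheodorySolutions

variable {n : ℕ} {t₀ : ℝ} {x y v w : ℝ → EuclideanSpace ℝ (Fin n)}

theorem SolvesFrom.mono (h : SolvesFrom t₀ x v) {t₁ : ℝ} (ht₁ : t₀ ≤ t₁) : SolvesFrom t₁ x v := by
  intro t ht
  have hint : IntervalIntegrable v volume t₁ t := (h t₁ ht₁).1.symm.trans (h t (ht₁.trans ht)).1
  refine ⟨hint, ?_⟩
  rw [(h t (ht₁.trans ht)).2, (h t₁ ht₁).2, add_assoc,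
    intervalIntegral.integral_add_adjacent_intervals (h t₁ ht₁).1 hint]

theorem SolvesFrom.sub (hx : SolvesFrom t₀ x v) (hy : SolvesFrom t₀ y w) :
    SolvesFrom t₀ (x - y) (v - w) := by
  intro t ht
  refine ⟨(hx t ht).1.sub (hy t ht).1, ?_⟩
  simp only [Pi.sub_apply]
  rw [intervalIntegral.integral_sub (hx t ht).1 (hy t ht).1, (hx t ht).2, (hy t ht).2]
  abel

theorem SolvesFrom.congr (h : SolvesFrom t₀ x v) (hxy : EqOn x y (Ici t₀))
    (hvw : EqOn v w (Ici t₀)) : SolvesFrom t₀ y w := by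
  intro t ht
  have heq : EqOn v w (uIcc t₀ t) := hvw.mono (uIcc_of_le ht ▸ Icc_subset_Ici_self)
  refine ⟨(h t ht).1.congr (heq.mono uIoc_subset_uIcc), ?_⟩
  rw [← hxy ht, ← hxy self_mem_Ici, (h t ht).2, intervalIntegral.integral_congr heq]

theorem IsAdmissibleDelay.solvesFrom_comp_phi_iff {D : ℝ → ℝ} {κ R : ℝ}
    (hD : IsAdmissibleDelay D κ R) :
    SolvesFrom 0 (x ∘ phi D) (fun t => deriv (phi D) t • v (phi D t)) ↔
      SolvesFrom (phi D 0) x v := by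
  have hmono := hD.strictMonoOn.monotoneOn
  have hreparam {p : ℝ → Prop} : (∀ t ≥ phi D 0, p t) ↔ ∀ t ≥ 0, p (phi D t) :=
    ⟨fun hp t ht => hp _ (hmono self_mem_Ici ht ht), fun hp t ht => by
      obtain ⟨s, hs, rfl⟩ := hD.surjOn ht
      exact hp s hs⟩
  refine (forall₂_congr fun t ht => ?_).trans hreparam.symm
  have hcont : ContinuousOn (phi D) (Icc 0 t) := hD.continuousOn.mono Icc_subset_Ici_self
  have hderiv : ∀ s ∈ Ioo 0 t, HasDerivAt (phi D) (deriv (phi D) s) s := fun s hs =>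
    (hD.differentiableOn.differentiableAt (Ioi_mem_nhds hs.1)).hasDerivAt
  have hnonneg : ∀ s ∈ Ioo 0 t, 0 ≤ deriv (phi D) s := fun s hs =>
    hD.rate_pos.le.trans (hD.le_deriv s hs.1)
  have hle : phi D 0 ≤ phi D t := hmono self_mem_Ici ht ht
  refine and_congr ?_ (Eq.congr_right ?_)
  · rw [intervalIntegrable_iff_integrableOn_Icc_of_le ht,
      intervalIntegrable_iff_integrableOn_Icc_of_le hle]
    exact integrableOn_Icc_deriv_smul_iff_of_deriv_nonneg hcont hderiv hnonneg ht
  · rw [intervalIntegral.integral_of_le ht, intervalIntegral.integral_of_le hle,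
      ← integral_Icc_eq_integral_Ioc, ← integral_Icc_eq_integral_Ioc,
      integral_Icc_deriv_smul_of_deriv_nonneg hcont hderiv hnonneg ht, Function.comp_apply]

open NormedSpace

variable (L : EuclideanSpace ℝ (Fin n) →L[ℝ] EuclideanSpace ℝ (Fin n))

theorem SolvesFrom.eq_exp_add_integral (h : SolvesFrom t₀ x v) {t : ℝ} (ht : t₀ ≤ t) :
    x t = exp ((t - t₀) • L) (x t₀) + ∫ s in t₀..t, exp ((t - s) • L) (v s - L (x s)) :=
  DelayPredictor.eq_exp_add_integral L ht (h t ht).1 fun s hs => (h s hs.1).2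

theorem SolvesFrom.eq_exp (h : SolvesFrom t₀ x fun s => L (x s)) {t : ℝ} (ht : t₀ ≤ t) :
    x t = exp ((t - t₀) • L) (x t₀) := by
  simpa using h.eq_exp_add_integral L ht

theorem mul_exp_le_exp_half {c : ℝ} (hc : 0 < c) (t : ℝ) :
    t * Real.exp (-c * t) ≤ 2 / c * Real.exp (-(c / 2) * t) := by
  have hle : t ≤ 2 / c * Real.exp (c / 2 * t) := by
    rw [div_mul_eq_mul_div, le_div_iff₀ hc]
    linarith [Real.add_one_le_exp (c / 2 * t)]
  calc t * Real.exp (-c * t) ≤ 2 / c * Real.exp (c / 2 * t) * Real.exp (-c * t) := by gcongr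
    _ = 2 / c * Real.exp (-(c / 2) * t) := by rw [mul_assoc, ← Real.exp_add]; ring_nf

variable {L}

theorem SolvesFrom.norm_le_of_forcing_le {C c : ℝ} (hc : 0 < c)
    (hL : ∀ t ≥ (0 : ℝ), ‖exp (t • L)‖ ≤ C * Real.exp (-c * t)) (h : SolvesFrom 0 x v) {H : ℝ}
    (hv : ∀ s ≥ 0, ‖v s - L (x s)‖ ≤ H * Real.exp (-c * s)) {t : ℝ} (ht : 0 ≤ t) :
    ‖x t‖ ≤ C * (‖x 0‖ + 2 / c * H) * Real.exp (-(c / 2) * t) := by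
  have hC : 0 ≤ C := by simpa using (norm_nonneg _).trans (hL 0 le_rfl)
  have hH : 0 ≤ H := by simpa using (norm_nonneg _).trans (hv 0 le_rfl)
  have hforcing : ∀ s ∈ Ioc 0 t, ‖exp ((t - s) • L) (v s - L (x s))‖ ≤
      C * H * Real.exp (-c * t) := fun s hs => by
    calc ‖exp ((t - s) • L) (v s - L (x s))‖ ≤ ‖exp ((t - s) • L)‖ * ‖v s - L (x s)‖ :=
          ContinuousLinearMap.le_opNorm _ _
      _ ≤ (C * Real.exp (-c * (t - s))) * (H * Real.exp (-c * s)) := by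
          gcongr
          exacts [hL _ (sub_nonneg.2 hs.2), hv s hs.1.le]
      _ = C * H * (Real.exp (-c * (t - s)) * Real.exp (-c * s)) := by ring
      _ = C * H * Real.exp (-c * t) := by rw [← Real.exp_add]; ring_nf
  rw [h.eq_exp_add_integral L ht, sub_zero]
  calc ‖exp (t • L) (x 0) + ∫ s in 0..t, exp ((t - s) • L) (v s - L (x s))‖
      ≤ C * Real.exp (-c * t) * ‖x 0‖ + C * H * Real.exp (-c * t) * |t - 0| := by
        refine norm_add_le_of_le ((ContinuousLinearMap.le_opNorm _ _).trans ?_)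
          (intervalIntegral.norm_integral_le_of_norm_le_const (uIoc_of_le ht ▸ hforcing))
        gcongr
        exact hL t ht
    _ = C * ‖x 0‖ * Real.exp (-c * t) + C * H * (t * Real.exp (-c * t)) := by
        rw [sub_zero, abs_of_nonneg ht]
        ring
    _ ≤ C * ‖x 0‖ * Real.exp (-(c / 2) * t) + C * H * (2 / c * Real.exp (-(c / 2) * t)) := by
        gcongr C * ‖x 0‖ * Real.exp (-?_ * t) + C * H * ?_
        · exact half_le_self hc.le
        · exact mul_exp_le_exp_half hc t
    _ = C * (‖x 0‖ + 2 / c * H) * Real.exp (-(c / 2) * t) := by ring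

end CaratheodorySolutions

open scoped Matrix.Norms.L2Operator

section SquaredNorm

variable {E : Type*} [SeminormedAddCommGroup E] {x : E}

theorem enorm_sq_le_ofReal_sq {a : ℝ} (h : ‖x‖ ≤ a) : ‖x‖ₑ ^ 2 ≤ ENNReal.ofReal (a ^ 2) := by
  rw [← ofReal_norm, ← ENNReal.ofReal_pow (norm_nonneg x)]
  gcongr

theorem norm_le_sqrt_toReal {a : ℝ≥0∞} (ha : a ≠ ⊤) (h : ‖x‖ₑ ^ 2 ≤ a) : ‖x‖ ≤ √a.toReal := by
  refine Real.le_sqrt_of_sq_le ?_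
  rw [← toReal_enorm, ← ENNReal.toReal_pow]
  exact ENNReal.toReal_mono ha h

end SquaredNorm

open scoped Matrix.Norms.L2Operator

section EuclideanMatrix

variable {ι κ : Type*} [Fintype ι] [DecidableEq ι] [Fintype κ]

theorem norm_toEuclideanLin_le (M : Matrix κ ι ℝ) (x : EuclideanSpace ℝ ι) :
    ‖Matrix.toEuclideanLin M x‖ ≤ ‖M‖ * ‖x‖ :=
  M.l2_opNorm_mulVec x

variable [DecidableEq κ]

theorem toEuclideanCLM_add_mul_apply (M : Matrix ι ι ℝ) (N : Matrix ι κ ℝ) (P : Matrix κ ι ℝ)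
    (x : EuclideanSpace ℝ ι) : Matrix.toEuclideanCLM (𝕜 := ℝ) (M + N * P) x =
      Matrix.toEuclideanLin M x + Matrix.toEuclideanLin N (Matrix.toEuclideanLin P x) := by
  change Matrix.toEuclideanLin (M + N * P) x = _
  rw [map_add, Matrix.toLpLin_mul_same, LinearMap.add_apply, LinearMap.comp_apply]

theorem toEuclideanCLM_sub_mul_apply (M : Matrix ι ι ℝ) (N : Matrix ι κ ℝ) (P : Matrix κ ι ℝ)
    (x : EuclideanSpace ℝ ι) : Matrix.toEuclideanCLM (𝕜 := ℝ) (M - N * P) x =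
      Matrix.toEuclideanLin M x - Matrix.toEuclideanLin N (Matrix.toEuclideanLin P x) := by
  change Matrix.toEuclideanLin (M - N * P) x = _
  rw [map_sub, Matrix.toLpLin_mul_same, LinearMap.sub_apply, LinearMap.comp_apply]

end EuclideanMatrix

namespace ControlSystem

variable {n m p : ℕ} (S : ControlSystem n m p)

theorem flow_eq (r : ℝ) (x : EuclideanSpace ℝ (Fin n)) :
    S.flow r x = NormedSpace.exp (r • Matrix.toEuclideanCLM (𝕜 := ℝ) S.A) x := by
  rw [← map_smul, ← toEuclideanCLM_exp]
  rfl

theorem flow_neg_flow (r : ℝ) (x : EuclideanSpace ℝ (Fin n)) : S.flow (-r) (S.flow r x) = x := by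
  rw [flow_eq, flow_eq, exp_neg_smul_apply_exp_smul]

theorem flow_sub (r : ℝ) (x y : EuclideanSpace ℝ (Fin n)) :
    S.flow r (x - y) = S.flow r x - S.flow r y :=
  map_sub _ x y

theorem exists_norm_flow_le (R : ℝ) :
    ∃ F > 0, ∀ r, |r| ≤ R → ∀ x, ‖S.flow r x‖ ≤ F * ‖x‖ := by
  obtain ⟨F, hF⟩ := (isCompact_Icc (a := -R) (b := R)).exists_bound_of_continuousOn
    (continuous_exp_smul S.A).continuousOn
  refine ⟨max F 1, by positivity, fun r hr x => (norm_toEuclideanLin_le _ x).trans ?_⟩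
  gcongr
  exact (hF r (abs_le.1 hr)).trans (le_max_left _ _)

/-- The bound `G` on the three parts of `Γ(t)`, namely the plant state, the estimation error and
the input over the delay window. -/
structure StateBound (Z : ℝ → EuclideanSpace ℝ (Fin n)) (U : ℝ → EuclideanSpace ℝ (Fin m))
    (ξ : ℝ → EuclideanSpace ℝ (Fin n)) (t G : ℝ) : Prop where
  plant : ‖Z t‖ ≤ G
  error : ‖Z t - S.Zhat U ξ t‖ ≤ G
  input : ∀ τ ∈ Icc (S.φ₁ t) t, ‖U τ‖ ≤ G

variable {S} {κ₁ R₁ κ₂ R₂ : ℝ} {Z : ℝ → EuclideanSpace ℝ (Fin n)}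
  {Y : ℝ → EuclideanSpace ℝ (Fin p)} {U : ℝ → EuclideanSpace ℝ (Fin m)}
  {ξ : ℝ → EuclideanSpace ℝ (Fin n)}

theorem IsClosedLoopSolution.plant_eq (h : S.IsClosedLoopSolution Z Y U ξ) {a b : ℝ}
    (ha : S.φ₂ 0 ≤ a) (hab : a ≤ b) :
    Z b = S.flow (b - a) (Z a) +
      ∫ s in a..b, S.flow (b - s) (Matrix.toEuclideanLin S.B (U (S.φ₁ s))) := by
  simp only [flow_eq]
  rw [(h.plant.mono ha).eq_exp_add_integral (Matrix.toEuclideanCLM (𝕜 := ℝ) S.A) hab]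
  congr! 5 with s
  exact add_sub_cancel_left _ _

theorem IsClosedLoopSolution.observer_comp_phiInv (h : S.IsClosedLoopSolution Z Y U ξ)
    (hD₂ : IsAdmissibleDelay S.D₂ κ₂ R₂) :
    SolvesFrom (S.φ₂ 0) (ξ ∘ phiInv S.D₂) fun r =>
      Matrix.toEuclideanLin S.A (ξ (phiInv S.D₂ r)) + Matrix.toEuclideanLin S.B (U (S.φ₁ r)) +
        Matrix.toEuclideanLin S.L (Matrix.toEuclideanLin S.C (Z r) -
          Matrix.toEuclideanLin S.C (ξ (phiInv S.D₂ r))) := by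
  refine hD₂.solvesFrom_comp_phi_iff.1 (h.observer.congr (fun t ht => ?_) fun t ht => ?_)
  · rw [Function.comp_apply, Function.comp_apply, hD₂.phiInv_phi ht]
  · simp only [h.output t ht, hD₂.phiInv_phi ht]
    rfl

theorem IsClosedLoopSolution.observer_error_eq (h : S.IsClosedLoopSolution Z Y U ξ)
    (hD₂ : IsAdmissibleDelay S.D₂ κ₂ R₂) {t : ℝ} (ht : 0 ≤ t) :
    Z (S.φ₂ t) - ξ t = NormedSpace.exp ((S.φ₂ t - S.φ₂ 0) •
      Matrix.toEuclideanCLM (𝕜 := ℝ) (S.A - S.L * S.C)) (Z (S.φ₂ 0) - ξ 0) := by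
  have herror : SolvesFrom (S.φ₂ 0) (Z - ξ ∘ phiInv S.D₂) fun r =>
      Matrix.toEuclideanCLM (𝕜 := ℝ) (S.A - S.L * S.C) ((Z - ξ ∘ phiInv S.D₂) r) := by
    refine (h.plant.sub (h.observer_comp_phiInv hD₂)).congr (fun r _ => rfl) fun r _ => ?_
    simp only [Pi.sub_apply, Function.comp_apply, toEuclideanCLM_sub_mul_apply]
    simp only [map_sub, φ₁, phi]
    abel
  have heq := herror.eq_exp _ (hD₂.strictMonoOn.monotoneOn self_mem_Ici ht ht)
  simpa only [Pi.sub_apply, Function.comp_apply, φ₂, hD₂.phiInv_phi ht, hD₂.phiInv_phi le_rfl]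
    using heq

theorem IsClosedLoopSolution.sub_Zhat_eq (h : S.IsClosedLoopSolution Z Y U ξ)
    (hD₂ : IsAdmissibleDelay S.D₂ κ₂ R₂) {t : ℝ} (ht : 0 ≤ t) :
    Z t - S.Zhat U ξ t = S.flow (S.D₂ t) (Z (S.φ₂ t) - ξ t) := by
  have hsub : t - S.φ₂ t = S.D₂ t := sub_sub_cancel t (S.D₂ t)
  have hmono : S.φ₂ 0 ≤ S.φ₂ t := hD₂.strictMonoOn.monotoneOn self_mem_Ici ht ht
  have hle : S.φ₂ t ≤ t := hD₂.phi_le ht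
  rw [h.plant_eq hmono hle, Zhat, hsub, flow_sub]
  abel

theorem exists_norm_sub_Zhat_le (hD₂ : IsAdmissibleDelay S.D₂ κ₂ R₂)
    (hL : IsHurwitz (S.A - S.L * S.C)) :
    ∃ M > 0, ∃ c > 0, ∀ Z Y U ξ, S.IsClosedLoopSolution Z Y U ξ → ∀ t ≥ 0,
      ‖Z t - S.Zhat U ξ t‖ ≤ M * Real.exp (-c * t) * ‖Z 0 - S.Zhat U ξ 0‖ := by
  obtain ⟨C, hC, c, hc, hdecay⟩ := hL.exists_norm_exp_le
  obtain ⟨F, hF, hflow⟩ := S.exists_norm_flow_le R₂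
  refine ⟨F * C * F, by positivity, c * κ₂, mul_pos hc hD₂.rate_pos, fun Z Y U ξ h t ht => ?_⟩
  have hinitial : ‖Z (S.φ₂ 0) - ξ 0‖ ≤ F * ‖Z 0 - S.Zhat U ξ 0‖ := by
    rw [← S.flow_neg_flow (S.D₂ 0) (Z (S.φ₂ 0) - ξ 0), ← h.sub_Zhat_eq hD₂ le_rfl]
    exact hflow _ ((abs_neg _).trans_le (hD₂.abs_le le_rfl)) _
  have hgrowth : κ₂ * t ≤ S.φ₂ t - S.φ₂ 0 := by
    simpa only [sub_zero] using
      (show κ₂ * (t - 0) ≤ S.φ₂ t - S.φ₂ 0 from hD₂.mul_sub_le le_rfl ht)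
  have hobserver : ‖Z (S.φ₂ t) - ξ t‖ ≤
      C * Real.exp (-(c * κ₂) * t) * ‖Z (S.φ₂ 0) - ξ 0‖ := by
    rw [h.observer_error_eq hD₂ ht]
    refine (ContinuousLinearMap.le_opNorm _ _).trans ?_
    gcongr
    refine (hdecay _ ((mul_nonneg hD₂.rate_pos.le ht).trans hgrowth)).trans
      (mul_le_mul_of_nonneg_left (Real.exp_le_exp.2 ?_) hC.le)
    linarith [mul_le_mul_of_nonneg_left hgrowth hc.le]
  calc ‖Z t - S.Zhat U ξ t‖ ≤ F * ‖Z (S.φ₂ t) - ξ t‖ := by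
        rw [h.sub_Zhat_eq hD₂ ht]
        exact hflow _ (hD₂.abs_le ht) _
    _ ≤ F * (C * Real.exp (-(c * κ₂) * t) * (F * ‖Z 0 - S.Zhat U ξ 0‖)) := by
        gcongr
        exact hobserver.trans (by gcongr)
    _ = F * C * F * Real.exp (-(c * κ₂) * t) * ‖Z 0 - S.Zhat U ξ 0‖ := by ring

theorem IsClosedLoopSolution.control_phi_eq (h : S.IsClosedLoopSolution Z Y U ξ)
    (hD₁ : IsAdmissibleDelay S.D₁ κ₁ R₁) (hD₂ : IsAdmissibleDelay S.D₂ κ₂ R₂) {s : ℝ} (hs : 0 ≤ s)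
    (hpos : 0 < S.φ₁ s) :
    U (S.φ₁ s) = Matrix.toEuclideanLin S.K
      (Z s - S.flow (S.D₁ s) (Z (S.φ₁ s) - S.Zhat U ξ (S.φ₁ s))) := by
  have hψ : S.ψ (S.φ₁ s) = S.D₁ s := hD₁.horizon_phi hs
  have hsum : S.φ₁ s + S.D₁ s = s := sub_add_cancel s (S.D₁ s)
  have hsub : s - S.φ₁ s = S.D₁ s := sub_sub_cancel s (S.D₁ s)
  rw [h.control _ hpos, Phat, hψ, hsum,
    h.plant_eq ((hD₂.phi_le le_rfl).trans hpos.le) (hD₁.phi_le hs), hsub, flow_sub]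
  congr 1
  abel

theorem exists_norm_plant_le_of_phi_nonpos (hD₁ : IsAdmissibleDelay S.D₁ κ₁ R₁)
    (hD₂ : IsAdmissibleDelay S.D₂ κ₂ R₂) :
    ∃ M > 0, ∀ Z Y U ξ, S.IsClosedLoopSolution Z Y U ξ → ∀ G, S.StateBound Z U ξ 0 G →
      ∀ s ≥ 0, S.φ₁ s ≤ 0 → ‖Z s‖ ≤ M * G := by
  obtain ⟨F, hF, hflow⟩ := S.exists_norm_flow_le R₁
  have hR₁ : 0 ≤ R₁ := (abs_nonneg _).trans (hD₁.abs_le le_rfl)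
  refine ⟨F * (1 + ‖S.B‖ * R₁), by positivity, fun Z Y U ξ h G h₀ s hs hφs => ?_⟩
  have hsR : s ≤ R₁ := by linarith [hD₁.sub_le_phi hs, show phi S.D₁ s ≤ 0 from hφs]
  have hG : 0 ≤ G := (norm_nonneg _).trans h₀.plant
  have hmono := hD₁.strictMonoOn.monotoneOn
  have hforcing : ∀ r ∈ Ioc 0 s,
      ‖S.flow (s - r) (Matrix.toEuclideanLin S.B (U (S.φ₁ r)))‖ ≤ F * (‖S.B‖ * G) := by
    intro r hr
    refine (hflow _ (abs_le.2 ⟨by linarith [hr.2], by linarith [hr.1]⟩) _).trans ?_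
    gcongr
    refine (norm_toEuclideanLin_le _ _).trans ?_
    gcongr
    exact h₀.input _ ⟨hmono self_mem_Ici hr.1.le hr.1.le, (hmono hr.1.le hs hr.2).trans hφs⟩
  rw [h.plant_eq (hD₂.phi_le le_rfl) hs]
  calc ‖S.flow (s - 0) (Z 0) +
        ∫ r in 0..s, S.flow (s - r) (Matrix.toEuclideanLin S.B (U (S.φ₁ r)))‖
      ≤ F * G + F * (‖S.B‖ * G) * |s - 0| := by
        refine norm_add_le_of_le ((hflow _ ?_ _).trans ?_)
          (intervalIntegral.norm_integral_le_of_norm_le_const (uIoc_of_le hs ▸ hforcing))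
        · rwa [sub_zero, abs_of_nonneg hs]
        · gcongr
          exact h₀.plant
    _ ≤ F * G + F * (‖S.B‖ * G) * R₁ := by
        rw [sub_zero, abs_of_nonneg hs]
        gcongr
    _ = F * (1 + ‖S.B‖ * R₁) * G := by ring

theorem exists_norm_input_sub_le (hD₁ : IsAdmissibleDelay S.D₁ κ₁ R₁)
    (hD₂ : IsAdmissibleDelay S.D₂ κ₂ R₂) (hL : IsHurwitz (S.A - S.L * S.C)) :
    ∃ M > 0, ∃ c > 0, ∀ Z Y U ξ, S.IsClosedLoopSolution Z Y U ξ → ∀ G, S.StateBound Z U ξ 0 G →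
      ∀ s ≥ 0, ‖U (S.φ₁ s) - Matrix.toEuclideanLin S.K (Z s)‖ ≤ M * Real.exp (-c * s) * G := by
  obtain ⟨Mw, hMw, c, hc, herror⟩ := exists_norm_sub_Zhat_le hD₂ hL
  obtain ⟨Mz, hMz, hplant⟩ := exists_norm_plant_le_of_phi_nonpos hD₁ hD₂
  obtain ⟨F, hF, hflow⟩ := S.exists_norm_flow_le R₁
  refine ⟨(1 + ‖S.K‖ * Mz + ‖S.K‖ * (F * Mw)) * Real.exp (c * R₁), by positivity, c, hc,
    fun Z Y U ξ h G h₀ s hs => ?_⟩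
  have hG : 0 ≤ G := (norm_nonneg _).trans h₀.plant
  have hφ : s - R₁ ≤ S.φ₁ s := hD₁.sub_le_phi hs
  rw [mul_assoc (1 + ‖S.K‖ * Mz + ‖S.K‖ * (F * Mw)), ← Real.exp_add]
  rcases le_or_gt (S.φ₁ s) 0 with hφs | hφs
  · have hU : ‖U (S.φ₁ s)‖ ≤ G :=
      h₀.input _ ⟨hD₁.strictMonoOn.monotoneOn self_mem_Ici hs hs, hφs⟩
    have hexp : 1 ≤ Real.exp (c * R₁ + -c * s) := Real.one_le_exp (by nlinarith)
    calc ‖U (S.φ₁ s) - Matrix.toEuclideanLin S.K (Z s)‖ ≤ G + ‖S.K‖ * (Mz * G) :=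
          norm_sub_le_of_le hU ((norm_toEuclideanLin_le _ _).trans
            (by gcongr; exact hplant Z Y U ξ h G h₀ s hs hφs))
      _ = (1 + ‖S.K‖ * Mz + 0) * 1 * G := by ring
      _ ≤ _ := by gcongr; positivity
  · have hexp : Real.exp (-c * S.φ₁ s) ≤ Real.exp (c * R₁ + -c * s) :=
      Real.exp_le_exp.2 (by nlinarith)
    have hU : U (S.φ₁ s) - Matrix.toEuclideanLin S.K (Z s) = -Matrix.toEuclideanLin S.K
        (S.flow (S.D₁ s) (Z (S.φ₁ s) - S.Zhat U ξ (S.φ₁ s))) := by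
      rw [h.control_phi_eq hD₁ hD₂ hs hφs, map_sub, sub_sub_cancel_left]
    calc ‖U (S.φ₁ s) - Matrix.toEuclideanLin S.K (Z s)‖
        ≤ ‖S.K‖ * (F * ‖Z (S.φ₁ s) - S.Zhat U ξ (S.φ₁ s)‖) := by
          rw [hU, norm_neg]
          refine (norm_toEuclideanLin_le _ _).trans ?_
          gcongr
          exact hflow _ (hD₁.abs_le hs) _
      _ ≤ ‖S.K‖ * (F * (Mw * Real.exp (-c * S.φ₁ s) * G)) := by
          gcongr
          exact (herror Z Y U ξ h _ hφs.le).trans (by gcongr; exact h₀.error)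
      _ = (0 + ‖S.K‖ * (F * Mw)) * Real.exp (-c * S.φ₁ s) * G := by ring
      _ ≤ _ := by gcongr; positivity

theorem exists_norm_plant_le (hD₁ : IsAdmissibleDelay S.D₁ κ₁ R₁)
    (hD₂ : IsAdmissibleDelay S.D₂ κ₂ R₂) (hK : IsHurwitz (S.A + S.B * S.K))
    (hL : IsHurwitz (S.A - S.L * S.C)) :
    ∃ M > 0, ∃ c > 0, ∀ Z Y U ξ, S.IsClosedLoopSolution Z Y U ξ → ∀ G, S.StateBound Z U ξ 0 G →
      ∀ t ≥ 0, ‖Z t‖ ≤ M * Real.exp (-c * t) * G := by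
  obtain ⟨C, hC, cK, hcK, hdecay⟩ := hK.exists_norm_exp_le
  obtain ⟨H, hH, cL, hcL, hinput⟩ := exists_norm_input_sub_le hD₁ hD₂ hL
  have hc : 0 < min cK cL := lt_min hcK hcL
  refine ⟨C * (1 + 2 / min cK cL * (‖S.B‖ * H)), by positivity, min cK cL / 2, half_pos hc,
    fun Z Y U ξ h G h₀ t ht => ?_⟩
  have hG : 0 ≤ G := (norm_nonneg _).trans h₀.plant
  have hdecay' : ∀ t ≥ (0 : ℝ), ‖NormedSpace.exp (t •
      Matrix.toEuclideanCLM (𝕜 := ℝ) (S.A + S.B * S.K))‖ ≤ C * Real.exp (-min cK cL * t) :=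
    fun t ht => (hdecay t ht).trans (by gcongr; exact min_le_left _ _)
  have hforcing : ∀ s ≥ 0, ‖Matrix.toEuclideanLin S.A (Z s) +
      Matrix.toEuclideanLin S.B (U (s - S.D₁ s)) -
        Matrix.toEuclideanCLM (𝕜 := ℝ) (S.A + S.B * S.K) (Z s)‖ ≤
      ‖S.B‖ * (H * G) * Real.exp (-min cK cL * s) := fun s hs => by
    rw [toEuclideanCLM_add_mul_apply, add_sub_add_left_eq_sub, ← map_sub]
    calc _ ≤ ‖S.B‖ * (H * Real.exp (-cL * s) * G) :=
          (norm_toEuclideanLin_le _ _).trans (by gcongr; exact hinput Z Y U ξ h G h₀ s hs)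
      _ ≤ ‖S.B‖ * (H * Real.exp (-min cK cL * s) * G) := by gcongr; exact min_le_right _ _
      _ = ‖S.B‖ * (H * G) * Real.exp (-min cK cL * s) := by ring
  calc ‖Z t‖ ≤ C * (‖Z 0‖ + 2 / min cK cL * (‖S.B‖ * (H * G))) *
        Real.exp (-(min cK cL / 2) * t) :=
        (h.plant.mono (hD₂.phi_le le_rfl)).norm_le_of_forcing_le hc hdecay' hforcing ht
    _ ≤ C * (G + 2 / min cK cL * (‖S.B‖ * (H * G))) * Real.exp (-(min cK cL / 2) * t) := by
        gcongr
        exact h₀.plant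
    _ = C * (1 + 2 / min cK cL * (‖S.B‖ * H)) * Real.exp (-(min cK cL / 2) * t) * G := by ring

theorem exists_norm_input_le (hD₁ : IsAdmissibleDelay S.D₁ κ₁ R₁)
    (hD₂ : IsAdmissibleDelay S.D₂ κ₂ R₂) (hK : IsHurwitz (S.A + S.B * S.K))
    (hL : IsHurwitz (S.A - S.L * S.C)) :
    ∃ M > 0, ∃ c > 0, ∀ Z Y U ξ, S.IsClosedLoopSolution Z Y U ξ → ∀ G, S.StateBound Z U ξ 0 G →
      ∀ t ≥ 0, ∀ τ ∈ Icc (S.φ₁ t) t, ‖U τ‖ ≤ M * Real.exp (-c * t) * G := by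
  obtain ⟨Mz, hMz, cz, hcz, hplant⟩ := exists_norm_plant_le hD₁ hD₂ hK hL
  obtain ⟨Mu, hMu, cu, hcu, hinput⟩ := exists_norm_input_sub_le hD₁ hD₂ hL
  refine ⟨Mu + ‖S.K‖ * Mz, by positivity, min cu cz, lt_min hcu hcz,
    fun Z Y U ξ h G h₀ t ht τ hτ => ?_⟩
  have hG : 0 ≤ G := (norm_nonneg _).trans h₀.plant
  have hφ : S.φ₁ 0 ≤ S.φ₁ t := hD₁.strictMonoOn.monotoneOn self_mem_Ici ht ht
  obtain ⟨s, hs, rfl⟩ : τ ∈ S.φ₁ '' Ici 0 := hD₁.surjOn (hφ.trans hτ.1)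
  have hts : t ≤ s := (hD₁.strictMonoOn.le_iff_le ht hs).1 hτ.1
  have hexp {c : ℝ} (hc : min cu cz ≤ c) : Real.exp (-c * s) ≤ Real.exp (-min cu cz * t) :=
    Real.exp_le_exp.2 (by
      simpa only [neg_mul, neg_le_neg_iff] using
        mul_le_mul hc hts ht ((lt_min hcu hcz).le.trans hc))
  calc ‖U (S.φ₁ s)‖
      ≤ ‖U (S.φ₁ s) - Matrix.toEuclideanLin S.K (Z s)‖ + ‖Matrix.toEuclideanLin S.K (Z s)‖ :=
        norm_le_norm_sub_add _ _
    _ ≤ Mu * Real.exp (-cu * s) * G + ‖S.K‖ * (Mz * Real.exp (-cz * s) * G) := by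
        refine add_le_add (hinput Z Y U ξ h G h₀ s hs) ((norm_toEuclideanLin_le _ _).trans ?_)
        gcongr
        exact hplant Z Y U ξ h G h₀ s hs
    _ ≤ Mu * Real.exp (-min cu cz * t) * G + ‖S.K‖ * (Mz * Real.exp (-min cu cz * t) * G) := by
        gcongr Mu * ?_ * G + ‖S.K‖ * (Mz * ?_ * G)
        exacts [hexp (min_le_left _ _), hexp (min_le_right _ _)]
    _ = (Mu + ‖S.K‖ * Mz) * Real.exp (-min cu cz * t) * G := by ring

theorem exists_stateBound (hD₁ : IsAdmissibleDelay S.D₁ κ₁ R₁)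
    (hD₂ : IsAdmissibleDelay S.D₂ κ₂ R₂) (hK : IsHurwitz (S.A + S.B * S.K))
    (hL : IsHurwitz (S.A - S.L * S.C)) :
    ∃ M > 0, ∃ c > 0, ∀ Z Y U ξ, S.IsClosedLoopSolution Z Y U ξ → ∀ G, S.StateBound Z U ξ 0 G →
      ∀ t ≥ 0, S.StateBound Z U ξ t (M * Real.exp (-c * t) * G) := by
  obtain ⟨Mz, hMz, cz, hcz, hplant⟩ := exists_norm_plant_le hD₁ hD₂ hK hL
  obtain ⟨Me, hMe, ce, hce, herror⟩ := exists_norm_sub_Zhat_le hD₂ hL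
  obtain ⟨Mu, hMu, cu, hcu, hinput⟩ := exists_norm_input_le hD₁ hD₂ hK hL
  refine ⟨Mz + Me + Mu, by positivity, min cz (min ce cu), lt_min hcz (lt_min hce hcu),
    fun Z Y U ξ h G h₀ t ht => ?_⟩
  have hG : 0 ≤ G := (norm_nonneg _).trans h₀.plant
  have hle {M c : ℝ} (hM : M ≤ Mz + Me + Mu) (hc : min cz (min ce cu) ≤ c) :
      M * Real.exp (-c * t) * G ≤
        (Mz + Me + Mu) * Real.exp (-min cz (min ce cu) * t) * G := by
    gcongr
  refine ⟨(hplant Z Y U ξ h G h₀ t ht).trans (hle (by linarith) (min_le_left _ _)), ?_,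
    fun τ hτ => (hinput Z Y U ξ h G h₀ t ht τ hτ).trans
      (hle (by linarith) ((min_le_right _ _).trans (min_le_right _ _)))⟩
  calc ‖Z t - S.Zhat U ξ t‖ ≤ Me * Real.exp (-ce * t) * G :=
        (herror Z Y U ξ h t ht).trans (by gcongr; exact h₀.error)
    _ ≤ _ := hle (by linarith) ((min_le_right _ _).trans (min_le_left _ _))

variable {t G : ℝ}

theorem StateBound.gam_le (h : S.StateBound Z U ξ t G) :
    S.Gam Z U ξ t ≤ 3 * ENNReal.ofReal (G ^ 2) := by
  calc S.Gam Z U ξ t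
      ≤ ENNReal.ofReal (G ^ 2) + ENNReal.ofReal (G ^ 2) + ENNReal.ofReal (G ^ 2) :=
        add_le_add (add_le_add (enorm_sq_le_ofReal_sq h.plant)
          (enorm_sq_le_ofReal_sq h.error))
          (iSup₂_le fun τ hτ => enorm_sq_le_ofReal_sq (h.input τ hτ))
    _ = 3 * ENNReal.ofReal (G ^ 2) := by ring

theorem stateBound_sqrt_gam (h : S.Gam Z U ξ t ≠ ⊤) :
    S.StateBound Z U ξ t √(S.Gam Z U ξ t).toReal where
  plant := norm_le_sqrt_toReal h (le_self_add.trans le_self_add)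
  error := norm_le_sqrt_toReal h (le_add_self.trans le_self_add)
  input τ hτ := by
    have hle : ‖U τ‖ₑ ^ 2 ≤ ⨆ σ ∈ Icc (S.φ₁ t) t, ‖U σ‖ₑ ^ 2 :=
      le_iSup₂ (f := fun σ (_ : σ ∈ Icc (S.φ₁ t) t) => ‖U σ‖ₑ ^ 2) τ hτ
    exact norm_le_sqrt_toReal h (hle.trans le_add_self)

end ControlSystem

end DelayPredictor

theorem theorem1_general {n m p : ℕ} (S : DelayPredictor.ControlSystem n m p) {κ₁ R₁ κ₂ R₂ : ℝ}
    (hD₁ : DelayPredictor.IsAdmissibleDelay S.D₁ κ₁ R₁)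
    (hD₂ : DelayPredictor.IsAdmissibleDelay S.D₂ κ₂ R₂)
    (hK : DelayPredictor.IsHurwitz (S.A + S.B * S.K))
    (hL : DelayPredictor.IsHurwitz (S.A - S.L * S.C)) :
    ∃ M > (0 : ℝ), ∃ C > (0 : ℝ),
      ∀ (Z : ℝ → EuclideanSpace ℝ (Fin n)) (Y : ℝ → EuclideanSpace ℝ (Fin p))
        (U : ℝ → EuclideanSpace ℝ (Fin m)) (ξ : ℝ → EuclideanSpace ℝ (Fin n)),
        S.IsClosedLoopSolution Z Y U ξ →
          ∀ t ≥ (0 : ℝ),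
            S.Gam Z U ξ t ≤ ENNReal.ofReal (M * Real.exp (-C * t)) * S.Gam Z U ξ 0 := by
  obtain ⟨M, hM, c, hc, hbound⟩ := DelayPredictor.ControlSystem.exists_stateBound hD₁ hD₂ hK hL
  refine ⟨3 * M ^ 2, by positivity, 2 * c, by positivity, fun Z Y U ξ h t ht => ?_⟩
  rcases eq_or_ne (S.Gam Z U ξ 0) ⊤ with htop | htop
  · rw [htop, ENNReal.mul_top (by positivity)]
    exact le_top
  have h₀ := DelayPredictor.ControlSystem.stateBound_sqrt_gam htop
  have hsq : (M * Real.exp (-c * t) * √(S.Gam Z U ξ 0).toReal) ^ 2 =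
      M ^ 2 * Real.exp (-(2 * c) * t) * (S.Gam Z U ξ 0).toReal := by
    rw [mul_pow, mul_pow, Real.sq_sqrt ENNReal.toReal_nonneg, ← Real.exp_nat_mul]
    ring_nf
  calc S.Gam Z U ξ t
      ≤ 3 * ENNReal.ofReal ((M * Real.exp (-c * t) * √(S.Gam Z U ξ 0).toReal) ^ 2) :=
        (hbound Z Y U ξ h _ h₀ t ht).gam_le
    _ = ENNReal.ofReal (3 * M ^ 2 * Real.exp (-(2 * c) * t)) * S.Gam Z U ξ 0 := by
        rw [hsq, ENNReal.ofReal_mul (by positivity), ENNReal.ofReal_toReal htop, ← mul_assoc,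
          ← ENNReal.ofReal_ofNat 3, ← ENNReal.ofReal_mul (by positivity), ← mul_assoc]

theorem theorem1 {n m p : ℕ} (S : DelayPredictor.ControlSystem n m p)
    (hreg₁ : DelayPredictor.RegularDelay S.D₁) (hreg₂ : DelayPredictor.RegularDelay S.D₂)
    (hpos₁ : DelayPredictor.DelayPositiveBounded S.D₁)
    (hpos₂ : DelayPredictor.DelayPositiveBounded S.D₂)
    (hinv₁ : DelayPredictor.DelayInvertible S.D₁)
    (hinv₂ : DelayPredictor.DelayInvertible S.D₂)
    (hK : DelayPredictor.IsHurwitz (S.A + S.B * S.K))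
    (hL : DelayPredictor.IsHurwitz (S.A - S.L * S.C)) :
    ∃ M > (0 : ℝ), ∃ C > (0 : ℝ),
      ∀ (Z : ℝ → EuclideanSpace ℝ (Fin n)) (Y : ℝ → EuclideanSpace ℝ (Fin p))
        (U : ℝ → EuclideanSpace ℝ (Fin m)) (ξ : ℝ → EuclideanSpace ℝ (Fin n)),
        S.IsClosedLoopSolution Z Y U ξ →
          ∀ t ≥ (0 : ℝ),
            S.Gam Z U ξ t ≤ ENNReal.ofReal (M * Real.exp (-C * t)) * S.Gam Z U ξ 0 := by
  obtain ⟨κ₁, R₁, hD₁⟩ := hreg₁.exists_isAdmissibleDelay hpos₁ hinv₁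
  obtain ⟨κ₂, R₂, hD₂⟩ := hreg₂.exists_isAdmissibleDelay hpos₂ hinv₂
  exact theorem1_general S hD₁ hD₂ hK hL
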